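/- Let $f\colon\mathbb R^n\to\mathbb R$ be locally Lipschitz continuous, let $F\colon\mathbb R^n\rightrightarrows\mathbb R^m$ and $G\colon\mathbb R^n\times\mathbb R^m\rightrightarrows\mathbb R^s$ be set-valued mappings with closed graphs, and let $M\subset\mathbb R^n$ be closed. Put $H(z):=\bigcup_{\lambda\in F(z)}G(z,\lambda)$ and consider the problem $$\text{(P)}\qquad f(z)\to\min_z\quad\text{subject to}\quad 0\in H(z),\ z\in M .$$ **Notation.** Product spaces carry the usual Euclidean structure. - A set-valued mapping $\Upsilon$ has graph $\operatorname{gph}\Upsilon:=\{(x,y)\mid y\in\Upsilon(x)\}$ and domain $\operatorname{dom}\Upsilon:=\{x\mid\Upsilon(x)\ne\varnothing\}$. It is *metrically subregular* at $(\bar x,\bar y)$ if there are $\kappa>0$ and a neighborhood $U$ of $\bar x$ with $\operatorname{dist}(x,\Upsilon^{-1}(\bar y))\le\kappa\operatorname{dist}(\bar y,\Upsilon(x))$ for all $x\in U$, where $\operatorname{dist}(\cdot,\varnothing)=\infty$. It is *inner semicompact* at $\bar x$ w.r.t. $\Omega$ if each sequence $(x_k)\subset\Omega$ with $x_k\to\bar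 x$ has a subsequence $(x_{k_l})$ for which there is a convergent sequence $(y_l)$ with $y_l\in\Upsilon(x_{k_l})$ for all $l$. - $\mathcal T_A(x):=\{d\mid\exists\,x_k\in A,\ t_k>0\colon x_k\to x,\ t_k\to0,\ (x_k-x)/t_k\to d\}$ is the tangent cone to $A$ at $x$. The regular normal cone is $\widehat{\mathcal N}_A(x):=\{\xi\mid\xi^\top d\le0\ \forall d\in\mathcal T_A(x)\}$, and the limiting normal cone is $\mathcal N_A(x):=\{\xi\mid\exists\,x_k\in A,\ \xi_k\in\widehat{\mathcal N}_A(x_k)\colon x_k\to x,\ \xi_k\to\xi\}$. - $\partial f(x):=\{\xi\mid(\xi,-1)\in\mathcal N_{\operatorname{epi}f}(x,f(x))\}$ with $\operatorname{epi}f:=\{(z,t)\in\mathbb R^n\times\mathbb R\mid t\ge f(z)\}$ is the limiting subdifferential, and $D^*\Upsilon(x,y)(\eta):=\{\xi\mid(\xi,-\eta)\in\mathcal N_{\operatorname{gph}\Upsilon}(x,y)\}$ is the limiting coderivative. Set $$K(z):=\{\lambda\in F(z)\mid 0\in G(z,\lambda)\},\qquad \widehat K(z,w):=\{\lambda\in F(z)\mid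 w\in G(z,\lambda)\},$$ $$H_M(z):=H(z)\times(z-M),\qquad \mathcal H(z,\lambda):=(F(z)-\lambda)\times G(z,\lambda),\qquad \mathcal H_M(z,\lambda):=\mathcal H(z,\lambda)\times(z-M),$$ $$\widehat{\mathcal H}(z,w,\lambda):=(F(z)-\lambda)\times(G(z,\lambda)-w),$$ $$\mathfrak H_M(z,\lambda):=\bigl((z,\lambda)-\operatorname{gph}F\bigr)\times\bigl((z,\lambda,0)-\operatorname{gph}G\bigr)\times(z-M).$$ For $\bar z\in\mathbb R^n$ and $\lambda\in\mathbb R^m$, let $\mathrm{Inc}(\lambda)$ be the condition $$D^*\mathcal H((\bar z,\lambda),(0,0))(\mu,\nu)\subset D^*F(\bar z,\lambda)(\mu)\times\{-\mu\}+D^*G((\bar z,\lambda),0)(\nu)\qquad\forall\mu\in\mathbb R^m,\ \nu\in\mathbb R^s.$$ **Theorem.** Let $\bar z\in\mathbb R^n$ be a local minimizer of (P), and assume that at least one of the following conditions holds. (a) $H_M$ is metrically subregular at $(\bar z,(0,0))$; $\widehat K$ is inner semicompact at $(\bar z,0)$ w.r.t. $\operatorname{dom}\widehat K$; and for each $\lambda\in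 K(\bar z)$, $\widehat{\mathcal H}$ is metrically subregular at $((\bar z,0,\lambda),(0,0))$ and $\mathrm{Inc}(\lambda)$ holds. (b) $H_M$ is metrically subregular at $(\bar z,(0,0))$; the mapping $(z,w)\rightrightarrows\{(z,\lambda)\mid\lambda\in F(z),\ w\in G(z,\lambda)\}$ is inner semicompact at $(\bar z,0)$ w.r.t. its domain; and for each $\lambda\in K(\bar z)$, the mapping $(z,w,q,\lambda')\rightrightarrows\{z-q\}\times(F(z)-\lambda')\times(G(q,\lambda')-w)$ is metrically subregular at $((\bar z,0,\bar z,\lambda),(0,0,0))$. (c) There is $\bar\lambda\in K(\bar z)$ such that $\mathcal H_M$ is metrically subregular at $((\bar z,\bar\lambda),(0,0,0))$ and $\mathrm{Inc}(\bar\lambda)$ holds. (d) There is $\bar\lambda\in K(\bar z)$ such that $\mathfrak H_M$ is metrically subregular at $((\bar z,\bar\lambda),((0,0),(0,0,0),0))$. Then $\bar z$ is explicitly M-stationary, i.e., there are $\bar\lambda\in K(\bar z)$, $\mu\in\mathbb R^m$ and $\nu\in\mathbb R^s$ with $$0\in\partial f(\bar z)+D^*F(\bar z,\bar\lambda)(\mu)+\{\xi\in\mathbb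 R^n\mid(\xi,\mu)\in D^*G((\bar z,\bar\lambda),0)(\nu)\}+\mathcal N_M(\bar z).$$ -/

import Mathlib

open Set Filter Topology
open scoped Pointwise

namespace ImplicitVar

/-- The product `E × F` of two Euclidean spaces, again as a Euclidean space: the inner product is
the sum of the inner products. Its norm is equivalent to the sum of the norms (and to the maximum),
so closedness, convergence and metric subregularity are the same for all of them. -/
abbrev Prod2 (E F : Type*) : Type _ := WithLp 2 (E × F)

/-- The element `(x, y)` of `Prod2 E F`. -/
abbrev pair {E F : Type*} (x : E) (y : F) : Prod2 E F := WithLp.toLp 2 (x, y)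

/-- The Cartesian product `A × B` as a subset of `Prod2 E F`. -/
def setProd {E F : Type*} (A : Set E) (B : Set F) : Set (Prod2 E F) :=
  {p | p.fst ∈ A ∧ p.snd ∈ B}

section General

/-- The graph of a set-valued mapping. -/
def gph {E F : Type*} (S : E → Set F) : Set (Prod2 E F) := {p | p.snd ∈ S p.fst}

/-- The domain of a set-valued mapping. -/
def dom {E F : Type*} (S : E → Set F) : Set E := {z | (S z).Nonempty}

/-- `S` is metrically subregular at `(z₀, w₀)`: for some `κ > 0` and all `z` near `z₀`,
`dist (z, S⁻¹(w₀)) ≤ κ * dist (w₀, S z)`. Distances are extended-valued, so that the distance to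
the empty set is `∞`. -/
def MetricallySubregularAt {E F : Type*} [NormedAddCommGroup E] [NormedAddCommGroup F]
    (S : E → Set F) (z₀ : E) (w₀ : F) : Prop :=
  ∃ κ : ℝ, 0 < κ ∧ ∃ U ∈ 𝓝 z₀, ∀ z ∈ U,
    Metric.infEDist z {x | w₀ ∈ S x} ≤ ENNReal.ofReal κ * Metric.infEDist w₀ (S z)

/-- `S` is inner semicompact at `z₀` with respect to `Ω`: every sequence in `Ω` converging to `z₀`
has a subsequence along which a convergent sequence can be selected from the values of `S`. -/
def InnerSemicompactAt {E F : Type*} [TopologicalSpace E] [TopologicalSpace F]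
    (S : E → Set F) (z₀ : E) (Ω : Set E) : Prop :=
  ∀ z : ℕ → E, (∀ k, z k ∈ Ω) → Tendsto z atTop (𝓝 z₀) →
    ∃ φ : ℕ → ℕ, StrictMono φ ∧ ∃ (w : ℕ → F) (w₀ : F),
      Tendsto w atTop (𝓝 w₀) ∧ ∀ l, w l ∈ S (z (φ l))

variable {E F : Type*} [NormedAddCommGroup E] [InnerProductSpace ℝ E]
  [NormedAddCommGroup F] [InnerProductSpace ℝ F]

/-- The Bouligand tangent cone to `A` at `z₀`. -/
def tangentCone (A : Set E) (z₀ : E) : Set E :=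
  {d | ∃ (z : ℕ → E) (t : ℕ → ℝ), (∀ k, z k ∈ A) ∧ (∀ k, 0 < t k) ∧
    Tendsto z atTop (𝓝 z₀) ∧ Tendsto t atTop (𝓝 0) ∧
    Tendsto (fun k => (t k)⁻¹ • (z k - z₀)) atTop (𝓝 d)}

/-- The polar cone. -/
def polarCone (A : Set E) : Set E := {ξ | ∀ a ∈ A, inner ℝ ξ a ≤ 0}

/-- The regular (Fréchet) normal cone. -/
def regularNormalCone (A : Set E) (z₀ : E) : Set E := polarCone (tangentCone A z₀)

/-- The limiting (Mordukhovich) normal cone. -/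
def limitingNormalCone (A : Set E) (z₀ : E) : Set E :=
  {ξ | ∃ (z : ℕ → E) (x : ℕ → E), (∀ k, z k ∈ A) ∧
    Tendsto z atTop (𝓝 z₀) ∧ Tendsto x atTop (𝓝 ξ) ∧ ∀ k, x k ∈ regularNormalCone A (z k)}

/-- The limiting subdifferential, via the limiting normal cone to the epigraph. -/
def limitingSubdifferential (φ : E → ℝ) (z₀ : E) : Set E :=
  {ξ | pair ξ (-1 : ℝ) ∈
    limitingNormalCone ({p | φ p.fst ≤ p.snd} : Set (Prod2 E ℝ)) (pair z₀ (φ z₀))}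

/-- The limiting coderivative `D*S(z₀, w₀)(η)`. -/
def coderivative (S : E → Set F) (z₀ : E) (w₀ : F) (η : F) : Set E :=
  {ξ | pair ξ (-η) ∈ limitingNormalCone (gph S) (pair z₀ w₀)}

end General

section Problem

/-! Variables: `z : Z` is the decision variable, `l : L` the implicit variable, and `w : W` ranges
over the target space of `G`. -/

variable {Z L W : Type*} [NormedAddCommGroup Z] [InnerProductSpace ℝ Z]
  [NormedAddCommGroup L] [InnerProductSpace ℝ L] [NormedAddCommGroup W] [InnerProductSpace ℝ W]

/-- `H(z) = ⋃_{l ∈ F(z)} G(z, l)`. -/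
def mapH (F : Z → Set L) (G : Prod2 Z L → Set W) (z : Z) : Set W :=
  ⋃ l ∈ F z, G (pair z l)

/-- The feasible set `{z ∈ M | 0 ∈ H(z)}` of the problem. -/
def feasibleSet (F : Z → Set L) (G : Prod2 Z L → Set W) (M : Set Z) : Set Z :=
  {z | 0 ∈ mapH F G z ∧ z ∈ M}

/-- `z₀` is a local minimizer of `f` subject to `0 ∈ H(z)`, `z ∈ M`. -/
def IsLocalMinimizer (f : Z → ℝ) (F : Z → Set L) (G : Prod2 Z L → Set W) (M : Set Z)
    (z₀ : Z) : Prop :=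
  z₀ ∈ feasibleSet F G M ∧ IsLocalMinOn f (feasibleSet F G M) z₀

/-- `K(z) = {l ∈ F(z) | 0 ∈ G(z, l)}`. -/
def mapK (F : Z → Set L) (G : Prod2 Z L → Set W) (z : Z) : Set L :=
  {l | l ∈ F z ∧ 0 ∈ G (pair z l)}

/-- `K̂(z, w) = {l ∈ F(z) | w ∈ G(z, l)}`. -/
def mapKHat (F : Z → Set L) (G : Prod2 Z L → Set W) (p : Prod2 Z W) : Set L :=
  {l | l ∈ F p.fst ∧ p.snd ∈ G (pair p.fst l)}

/-- The mapping `(z, w) ⇉ {(z, l) | l ∈ F(z), w ∈ G(z, l)}`. -/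
def mapKTilde (F : Z → Set L) (G : Prod2 Z L → Set W) (p : Prod2 Z W) : Set (Prod2 Z L) :=
  {q | ∃ l, q = pair p.fst l ∧ l ∈ F p.fst ∧ p.snd ∈ G (pair p.fst l)}

/-- `H_M(z) = H(z) × (z - M)`. -/
def mapHM (F : Z → Set L) (G : Prod2 Z L → Set W) (M : Set Z) (z : Z) : Set (Prod2 W Z) :=
  setProd (mapH F G z) ({z} - M)

/-- `𝓗(z, l) = (F(z) - l) × G(z, l)`. -/
def mapCalH (F : Z → Set L) (G : Prod2 Z L → Set W) (p : Prod2 Z L) : Set (Prod2 L W) :=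
  setProd (F p.fst - {p.snd}) (G p)

/-- `𝓗_M(z, l) = (F(z) - l) × G(z, l) × (z - M)`. -/
def mapCalHM (F : Z → Set L) (G : Prod2 Z L → Set W) (M : Set Z) (p : Prod2 Z L) :
    Set (Prod2 (Prod2 L W) Z) :=
  setProd (mapCalH F G p) ({p.fst} - M)

/-- `𝔥(z, l) = ((z, l) - gph F) × ((z, l, 0) - gph G)`. -/
def mapFrakH (F : Z → Set L) (G : Prod2 Z L → Set W) (p : Prod2 Z L) :
    Set (Prod2 (Prod2 Z L) (Prod2 (Prod2 Z L) W)) :=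
  setProd ({p} - gph F) ({pair p (0 : W)} - gph G)

/-- `𝔥_M(z, l) = ((z, l) - gph F) × ((z, l, 0) - gph G) × (z - M)`. -/
def mapFrakHM (F : Z → Set L) (G : Prod2 Z L → Set W) (M : Set Z) (p : Prod2 Z L) :
    Set (Prod2 (Prod2 (Prod2 Z L) (Prod2 (Prod2 Z L) W)) Z) :=
  setProd (mapFrakH F G p) ({p.fst} - M)

/-- `Ĥ(z, w, l) = (F(z) - l) × (G(z, l) - w)`; the argument is `((z, w), l)`. -/
def mapHHat (F : Z → Set L) (G : Prod2 Z L → Set W) (p : Prod2 (Prod2 Z W) L) :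
    Set (Prod2 L W) :=
  setProd (F p.fst.fst - {p.snd}) (G (pair p.fst.fst p.snd) - {p.fst.snd})

/-- The mapping `(z, w, q, l) ⇉ (z - q, F(z) - l, G(q, l) - w)`; the argument is
`((z, w), (q, l))`. -/
def mapHTilde (F : Z → Set L) (G : Prod2 Z L → Set W) (p : Prod2 (Prod2 Z W) (Prod2 Z L)) :
    Set (Prod2 Z (Prod2 L W)) :=
  setProd {p.fst.fst - p.snd.fst}
    (setProd (F p.fst.fst - {p.snd.snd}) (G p.snd - {p.fst.snd}))

/-- The inclusion `Inc(l)` at `z₀`: for all `μ`, `ν`,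
`D*𝓗((z₀, l), (0, 0))(μ, ν) ⊆ D*F(z₀, l)(μ) × {-μ} + D*G((z₀, l), 0)(ν)`. -/
def Inc (F : Z → Set L) (G : Prod2 Z L → Set W) (z₀ : Z) (l : L) : Prop :=
  ∀ (μ : L) (ν : W),
    coderivative (mapCalH F G) (pair z₀ l) 0 (pair μ ν) ⊆
      setProd (coderivative F z₀ l μ) {-μ} + coderivative G (pair z₀ l) 0 ν

/-- `z₀` is explicitly M-stationary: there are `l ∈ K(z₀)`, `μ`, `ν` with
`0 ∈ ∂f(z₀) + D*F(z₀, l)(μ) + {ξ | (ξ, μ) ∈ D*G((z₀, l), 0)(ν)} + N_M(z₀)`. -/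
def ExplicitlyMStationary (f : Z → ℝ) (F : Z → Set L) (G : Prod2 Z L → Set W) (M : Set Z)
    (z₀ : Z) : Prop :=
  ∃ l ∈ mapK F G z₀, ∃ (μ : L) (ν : W),
    (0 : Z) ∈ limitingSubdifferential f z₀ + coderivative F z₀ l μ +
      {ξ : Z | pair ξ μ ∈ coderivative G (pair z₀ l) 0 ν} + limitingNormalCone M z₀

end Problem

end ImplicitVar

/-!
The proof is by exact penalization. Suppose that points `x` of a closed set `C` carry linear data
`B x` (the decision variable) and `A x` (a residual), and that `‖A x‖` bounds the distance of `B x`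
to the feasible set up to a constant. Then a local minimizer of `f` on the feasible set is a local
minimizer of the penalty function `f (B x) + c * ‖A x‖` on `C`, for `c` large
(`exists_multipliers_of_errorBound`). The limiting sum rule in the form of
`exists_multipliers_of_isLocalMinOn` then provides a limiting subgradient `ξ` of `f` and a
multiplier `η` such that `-(B* ξ + A* η)` is a limiting normal to `C`. It is proved by minimizing
`f z + c * √(‖A x‖ ^ 2 + ε ^ 2) + k / 2 * ‖B x - z‖ ^ 2 + 1 / 2 * ‖x - x₀‖ ^ 2` over a compact set:
the minimizers satisfy the optimality conditions with regular normals, the multipliers stay bounded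
in terms of the Lipschitz constant of `f` and `c`, and a limit `k → ∞`, `ε → 0` along a subsequence gives
the claim.

Two choices of `C` are used. With `C = gph 𝓗 × M` the normal to `gph 𝓗` is split by the inclusion
`Inc`. With `C = gph F × gph G × M` the normals to the graphs of `F` and `G` come out directly. The
error bound is immediate from metric subregularity of `𝓗_M` and `𝔥_M`. In the other two cases it is
the composition of two subregularity estimates: one passes from `(z, l)` with residuals to a nearby
point of the graph of `H`, the other (for `H_M`) from there to the feasible set. A minimizer of
`f` on the feasible set is one for the penalized problem in `(z, l)` whichever `l ∈ K(z₀)` is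
chosen, so a single implicit variable, provided by the feasibility of `z₀`, is enough.
-/

namespace ImplicitVar

section Calculus

/-! ### Normal cones and multiplier rules -/

variable {X Y Z : Type*} [NormedAddCommGroup X] [InnerProductSpace ℝ X]
  [NormedAddCommGroup Y] [InnerProductSpace ℝ Y] [NormedAddCommGroup Z] [InnerProductSpace ℝ Z]

/-- Fermat's rule: the negative gradient of a differentiable function at a constrained local
minimizer is a regular normal. -/
theorem mem_regularNormalCone_of_isLocalMinOn {h : X → ℝ} {h' : X →L[ℝ] ℝ} {C : Set X} {x n : X}
    (hd : HasFDerivAt h h' x) (hmin : IsLocalMinOn h C x) (hn : ∀ d, inner ℝ n d = -h' d) :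
    n ∈ regularNormalCone C x := by
  rintro d ⟨z, t, hz, ht, hzx, -, hlim⟩
  rw [hn, neg_nonpos]
  have hz0 : Tendsto (fun k => z k - x) atTop (𝓝 0) := by
    simpa using hzx.sub_const x
  have hder := (hd.hasFDerivWithinAt (s := univ)).lim hz0 (by simp) hlim
  refine ge_of_tendsto hder ?_
  have hev : ∀ᶠ k in atTop, h x ≤ h (z k) :=
    (tendsto_nhdsWithin_iff.2 ⟨hzx, Eventually.of_forall hz⟩).eventually hmin
  filter_upwards [hev] with k hk
  have := inv_nonneg.2 (ht k).le
  simpa using mul_nonneg this (sub_nonneg.2 hk)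

theorem regularNormalCone_setProd_subset {A : Set X} {B : Set Y} {p n : Prod2 X Y}
    (hp : p ∈ setProd A B) (hn : n ∈ regularNormalCone (setProd A B) p) :
    n.fst ∈ regularNormalCone A p.fst ∧ n.snd ∈ regularNormalCone B p.snd := by
  constructor
  · rintro d ⟨z, t, hz, ht, hzx, ht0, hlim⟩
    have h := hn (pair d 0) ⟨fun k => pair (z k) p.snd, t, fun k => ⟨hz k, hp.2⟩, ht,
      ((WithLp.prod_continuous_toLp 2 X Y).tendsto _).comp
        (hzx.prodMk_nhds (tendsto_const_nhds (x := p.snd))), ht0, ?_⟩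
    · simpa [WithLp.prod_inner_apply] using h
    · have := ((WithLp.prod_continuous_toLp 2 X Y).tendsto _).comp
        (hlim.prodMk_nhds (tendsto_const_nhds (x := (0 : Y))))
      refine this.congr fun k => ?_
      apply WithLp.ofLp_injective
      ext <;> simp
  · rintro d ⟨z, t, hz, ht, hzx, ht0, hlim⟩
    have h := hn (pair 0 d) ⟨fun k => pair p.fst (z k), t, fun k => ⟨hp.1, hz k⟩, ht,
      ((WithLp.prod_continuous_toLp 2 X Y).tendsto _).comp
        ((tendsto_const_nhds (x := p.fst)).prodMk_nhds hzx), ht0, ?_⟩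
    · simpa [WithLp.prod_inner_apply] using h
    · have := ((WithLp.prod_continuous_toLp 2 X Y).tendsto _).comp
        ((tendsto_const_nhds (x := (0 : X))).prodMk_nhds hlim)
      refine this.congr fun k => ?_
      apply WithLp.ofLp_injective
      ext <;> simp

theorem limitingNormalCone_setProd_subset {A : Set X} {B : Set Y} {p n : Prod2 X Y}
    (hn : n ∈ limitingNormalCone (setProd A B) p) :
    n.fst ∈ limitingNormalCone A p.fst ∧ n.snd ∈ limitingNormalCone B p.snd := by
  obtain ⟨z, x, hz, hzp, hxn, hx⟩ := hn
  have h := fun k => regularNormalCone_setProd_subset (hz k) (hx k)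
  exact ⟨⟨fun k => (z k).fst, fun k => (x k).fst, fun k => (hz k).1,
      ((WithLp.continuous_fst 2 X Y).tendsto p).comp hzp,
      ((WithLp.continuous_fst 2 X Y).tendsto n).comp hxn, fun k => (h k).1⟩,
    ⟨fun k => (z k).snd, fun k => (x k).snd, fun k => (hz k).2,
      ((WithLp.continuous_snd 2 X Y).tendsto p).comp hzp,
      ((WithLp.continuous_snd 2 X Y).tendsto n).comp hxn, fun k => (h k).2⟩⟩

/-- The term `c * ‖A x‖` is replaced by `c * √(‖A x‖ ^ 2 + ε ^ 2)`, which is differentiable also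
where `A x = 0`, with a gradient of norm at most `c` in the variable `A x`. -/
theorem hasFDerivAt_smoothedPenalty (A : X →L[ℝ] Y) (B : X →L[ℝ] Z) (c k : ℝ) {ε : ℝ} (hε : 0 < ε)
    (x x₀ : X) (z : Z) : ∃ h' : X →L[ℝ] ℝ,
    HasFDerivAt (fun x => c * √(‖A x‖ ^ 2 + ε ^ 2) + k / 2 * ‖B x - z‖ ^ 2 + 1 / 2 * ‖x - x₀‖ ^ 2)
      h' x ∧
    ∀ d, h' d = inner ℝ ((c / √(‖A x‖ ^ 2 + ε ^ 2)) • A x) (A d) +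
      inner ℝ (k • (B x - z)) (B d) + inner ℝ (x - x₀) d := by
  have h1 : HasFDerivAt (fun x => ‖A x‖ ^ 2) _ x := A.hasFDerivAt.norm_sq
  have h2 : HasFDerivAt (fun x => ‖B x - z‖ ^ 2) _ x := (B.hasFDerivAt.sub_const z).norm_sq
  have h3 : HasFDerivAt (fun x => ‖x - x₀‖ ^ 2) _ x := ((hasFDerivAt_id x).sub_const x₀).norm_sq
  have hpos : 0 < ‖A x‖ ^ 2 + ε ^ 2 := by positivity
  have h4 := ((((h1.add_const (ε ^ 2)).sqrt hpos.ne').const_mul c).add (h2.const_mul (k / 2))).add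
    (h3.const_mul (1 / 2))
  refine ⟨_, h4, fun d => ?_⟩
  simp [inner_smul_left, -map_sub]
  field_simp

/-- One step of the sum rule: minimizing the penalty function over a ball, with `‖A x‖` smoothed
and `B x` decoupled from the argument of `f`, gives points near `x₀` and `B x₀` at which the
optimality condition holds with regular normals. The multipliers are bounded by constants that do
not depend on `δ`. -/
theorem exists_approximate_multipliers [FiniteDimensional ℝ X] [FiniteDimensional ℝ Y]
    [FiniteDimensional ℝ Z] {f : Z → ℝ} {C : Set X} (hC : IsClosed C)
    (A : X →L[ℝ] Y) (B : X →L[ℝ] Z) {x₀ : X} (hx₀ : x₀ ∈ C) (hA : A x₀ = 0) {c L r : ℝ}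
    (hc : 0 ≤ c) (hL : 0 ≤ L) (hr : 0 < r)
    (hf : ∀ z ∈ Metric.closedBall (B x₀) r, ∀ z' ∈ Metric.closedBall (B x₀) r,
      |f z - f z'| ≤ L * ‖z - z'‖)
    (hmin : IsLocalMinOn (fun x => f (B x) + c * ‖A x‖) C x₀) {δ : ℝ} (hδ : 0 < δ) :
    ∃ x ∈ C, ∃ (z ξ : Z) (η : Y), ‖x - x₀‖ < δ ∧ ‖z - B x₀‖ < δ ∧ ‖ξ‖ ≤ 2 * L ∧
      ‖η‖ ≤ c ∧
      pair ξ (-1 : ℝ) ∈ regularNormalCone ({p | f p.fst ≤ p.snd} : Set (Prod2 Z ℝ))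
        (pair z (f z)) ∧
      -(B.adjoint ξ + A.adjoint η + (x - x₀)) ∈ regularNormalCone C x := by
  -- a ball around `x₀` on which `x₀` is a minimizer and which `B` maps into the ball for `f`
  obtain ⟨ρ, hρ, hρmin⟩ : ∃ ρ > 0, ∀ x, ‖x - x₀‖ ≤ ρ →
      ρ < δ ∧ ‖B x - B x₀‖ < r / 2 ∧ ‖B x - B x₀‖ < δ / 2 ∧
      (x ∈ C → f (B x₀) ≤ f (B x) + c * ‖A x‖) := by
    have h1 : ∀ᶠ x in 𝓝 x₀, ‖B x - B x₀‖ < min (r / 2) (δ / 2) := by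
      have := (B.continuous.tendsto x₀).eventually
        (Metric.ball_mem_nhds (B x₀) (lt_min (half_pos hr) (half_pos hδ)))
      filter_upwards [this] with x hx
      rwa [← dist_eq_norm]
    have h2 := eventually_nhdsWithin_iff.1 hmin
    obtain ⟨ρ, hρ, h⟩ := Metric.eventually_nhds_iff.1 (h1.and h2)
    refine ⟨min (ρ / 2) (δ / 2), by positivity, fun x hx => ?_⟩
    obtain ⟨h3, h4⟩ := @h x (by
      rw [dist_eq_norm]; linarith [min_le_left (ρ / 2) (δ / 2)])
    refine ⟨by linarith [min_le_right (ρ / 2) (δ / 2)], h3.trans_le (min_le_left _ _),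
      h3.trans_le (min_le_right _ _), fun hxC => ?_⟩
    simpa [hA] using h4 hxC
  obtain ⟨k, hk0, hk1, hk2, hk3⟩ : ∃ k : ℝ, 0 < k ∧ 2 * L / k < r / 2 ∧ 2 * L / k < δ / 2 ∧
      (2 * c + 4 * L ^ 2) / k < ρ ^ 2 := by
    have t : ∀ a : ℝ, Tendsto (fun k : ℝ => a / k) atTop (𝓝 0) := fun a =>
      tendsto_const_nhds.div_atTop tendsto_id
    exact ((eventually_gt_atTop 0).and (((t _).eventually_lt_const (half_pos hr)).and
      (((t _).eventually_lt_const (half_pos hδ)).and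
        ((t _).eventually_lt_const (by positivity))))).exists
  have hε : (0 : ℝ) < 1 / k := by positivity
  set s : X → ℝ := fun x => √(‖A x‖ ^ 2 + (1 / k) ^ 2) with hs
  set g : X → Z → ℝ := fun x z => c * s x + k / 2 * ‖B x - z‖ ^ 2 + 1 / 2 * ‖x - x₀‖ ^ 2 with hg
  have hfc : ContinuousOn f (Metric.closedBall (B x₀) r) := by
    have : LipschitzOnWith L.toNNReal f (Metric.closedBall (B x₀) r) :=
      LipschitzOnWith.of_dist_le_mul fun z hz z' hz' => by
        rw [Real.dist_eq, dist_eq_norm, Real.coe_toNNReal _ hL]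
        exact hf z hz z' hz'
    exact this.continuousOn
  have hcomp : IsCompact ((C ∩ Metric.closedBall x₀ ρ) ×ˢ Metric.closedBall (B x₀) r) :=
    ((isCompact_closedBall x₀ ρ).inter_left hC).prod (isCompact_closedBall (B x₀) r)
  have hcont : ContinuousOn (fun p : X × Z => f p.2 + g p.1 p.2)
      ((C ∩ Metric.closedBall x₀ ρ) ×ˢ Metric.closedBall (B x₀) r) := by
    refine (hfc.comp continuousOn_snd fun p hp => hp.2).add (Continuous.continuousOn ?_)
    simp only [hg, hs]
    fun_prop
  obtain ⟨⟨x, z⟩, ⟨⟨hxC, hxρ⟩, hzr⟩, hxz⟩ := hcomp.exists_isMinOn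
    ⟨(x₀, B x₀), ⟨hx₀, Metric.mem_closedBall_self hρ.le⟩, Metric.mem_closedBall_self hr.le⟩ hcont
  have hxz' : ∀ x' ∈ C, ‖x' - x₀‖ ≤ ρ → ∀ z', ‖z' - B x₀‖ ≤ r → f z + g x z ≤ f z' + g x' z' :=
    fun x' h1 h2 z' h3 => hxz (a := (x', z')) ⟨⟨h1, by simpa [dist_eq_norm] using h2⟩, by
      simpa [dist_eq_norm] using h3⟩
  replace hxρ : ‖x - x₀‖ ≤ ρ := by simpa [dist_eq_norm] using hxρ
  obtain ⟨hρδ, hBr, hBδ, hBmin⟩ := hρmin x hxρ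
  have hzr' : ‖z - B x₀‖ ≤ r := by simpa [dist_eq_norm] using hzr
  have hBx : B x ∈ Metric.closedBall (B x₀) r := by
    rw [Metric.mem_closedBall, dist_eq_norm]; linarith
  have hLip := abs_le.1 (hf _ hBx z hzr)
  -- comparison with `(x, B x)` bounds the multiplier `k • (B x - z)`
  have hξ : k * ‖B x - z‖ ≤ 2 * L := by
    have h1 := hxz' x hxC hxρ (B x) (by linarith)
    simp only [hg, sub_self, norm_zero] at h1
    rcases (norm_nonneg (B x - z)).eq_or_lt with h0 | h0
    · rw [← h0]; linarith
    · refine le_of_mul_le_mul_right ?_ h0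
      nlinarith
  have hdist : ‖B x - z‖ ≤ 2 * L / k := by
    rw [le_div_iff₀ hk0]; linarith
  have hss : ∀ x, ‖A x‖ ≤ s x := fun x => Real.le_sqrt_of_sq_le (by nlinarith [sq_nonneg (1 / k)])
  -- comparison with `(x₀, B x₀)` shows that `x` is close to `x₀`
  have hxx₀ : ‖x - x₀‖ < ρ := by
    have h1 := hxz' x₀ hx₀ (by simpa using hρ.le) (B x₀) (by simpa using hr.le)
    have h0 : s x₀ = 1 / k := by simp [hs, hA, hk0.le]
    simp only [hg, sub_self, norm_zero, h0] at h1
    have h2 := hBmin hxC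
    have h3 := mul_le_mul_of_nonneg_left (hss x) hc
    have h4 := mul_le_mul_of_nonneg_left hdist hL
    have h5 : 0 ≤ k / 2 * ‖B x - z‖ ^ 2 := by positivity
    have h6 : (2 * c + 4 * L ^ 2) / k = 2 * (c * (1 / k)) + 2 * (L * (2 * L / k)) := by
      field_simp; ring
    have h7 : ‖x - x₀‖ ^ 2 < ρ ^ 2 := by nlinarith
    exact lt_of_pow_lt_pow_left₀ 2 hρ.le h7
  have hzz₀ : ‖z - B x₀‖ < r ∧ ‖z - B x₀‖ < δ := by
    have : ‖z - B x₀‖ ≤ ‖B x - z‖ + ‖B x - B x₀‖ := by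
      rw [norm_sub_rev (B x) z]; exact norm_sub_le_norm_sub_add_norm_sub _ _ _
    constructor <;> linarith
  have hspos : 0 < s x := Real.sqrt_pos.2 (by positivity)
  refine ⟨x, hxC, z, k • (B x - z), (c / s x) • A x, hxρ.trans_lt hρδ, hzz₀.2, ?_, ?_, ?_, ?_⟩
  · rwa [norm_smul, Real.norm_of_nonneg hk0.le]
  · rw [norm_smul, Real.norm_of_nonneg (by positivity), div_mul_eq_mul_div, div_le_iff₀ hspos]
    exact mul_le_mul_of_nonneg_left (hss x) hc
  · -- `(z, f z)` minimizes `t + k / 2 * ‖B x - z'‖ ^ 2` over the points `(z', t)` of the epigraph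
    have h2 : HasFDerivAt (fun p : Prod2 Z ℝ => ‖B x - p.fst‖ ^ 2) _ (pair z (f z)) :=
      ((WithLp.fstL 2 ℝ Z ℝ).hasFDerivAt.const_sub (B x)).norm_sq
    have h3 := (WithLp.sndL 2 ℝ Z ℝ).hasFDerivAt.add (h2.const_mul (k / 2))
      (x := (pair z (f z)))
    refine mem_regularNormalCone_of_isLocalMinOn h3 ?_ fun d => ?_
    · have : ∀ᶠ p : Prod2 Z ℝ in 𝓝 (pair z (f z)), ‖p.fst - B x₀‖ < r := by
        exact ((((WithLp.continuous_fst 2 Z ℝ).sub continuous_const).norm).tendsto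
          (pair z (f z))).eventually_lt_const hzz₀.1
      refine eventually_nhdsWithin_iff.2 ?_
      filter_upwards [this] with p hp hpe
      have h4 := hxz' x hxC hxρ p.fst hp.le
      have hpe' : f p.fst ≤ p.snd := hpe
      simp only [hg] at h4
      simp
      linarith
    · simp [WithLp.prod_inner_apply, inner_smul_left, inner_sub_left]
      ring
  · obtain ⟨h', hd, hh'⟩ := hasFDerivAt_smoothedPenalty A B c k hε x x₀ z
    refine mem_regularNormalCone_of_isLocalMinOn hd ?_ fun d => ?_
    · have : ∀ᶠ x' in 𝓝 x, ‖x' - x₀‖ < ρ :=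
        ((show Continuous fun x' => ‖x' - x₀‖ by fun_prop).tendsto x).eventually_lt_const hxx₀
      refine eventually_nhdsWithin_iff.2 ?_
      filter_upwards [this] with x' hx' hx'C
      exact le_of_add_le_add_left (hxz' x' hx'C hx'.le z hzr')
    · rw [hh', inner_neg_left, inner_add_left, inner_add_left,
        ContinuousLinearMap.adjoint_inner_left, ContinuousLinearMap.adjoint_inner_left]
      ring

/-- Multiplier rule for the composite penalty function `f (B x) + c * ‖A x‖` on a closed set. The
adjoints of `A` and `B` are hidden in the formula for the inner product with the normal `n`. -/
theorem exists_multipliers_of_isLocalMinOn [FiniteDimensional ℝ X] [FiniteDimensional ℝ Y]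
    [FiniteDimensional ℝ Z] {f : Z → ℝ} (hf : LocallyLipschitz f) {C : Set X} (hC : IsClosed C)
    (A : X →L[ℝ] Y) (B : X →L[ℝ] Z) {x₀ : X} (hx₀ : x₀ ∈ C) (hA : A x₀ = 0) {c : ℝ} (hc : 0 ≤ c)
    (hmin : IsLocalMinOn (fun x => f (B x) + c * ‖A x‖) C x₀) :
    ∃ ξ ∈ limitingSubdifferential f (B x₀), ∃ η : Y, ∃ n ∈ limitingNormalCone C x₀,
      ∀ d, inner ℝ n d = -(inner ℝ ξ (B d) + inner ℝ η (A d)) := by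
  obtain ⟨L, t, ht, hL⟩ := hf (B x₀)
  obtain ⟨r, hr, hrt⟩ := Metric.nhds_basis_closedBall.mem_iff.1 ht
  have hf' : ∀ z ∈ Metric.closedBall (B x₀) r, ∀ z' ∈ Metric.closedBall (B x₀) r,
      |f z - f z'| ≤ L * ‖z - z'‖ := fun z hz z' hz' => by
    simpa [Real.dist_eq, dist_eq_norm] using hL.dist_le_mul z (hrt hz) z' (hrt hz')
  have hδ : ∀ k : ℕ, (0 : ℝ) < 1 / (k + 1) := fun k => Nat.one_div_pos_of_nat
  choose x hxC z ξ η hx hz hξ hη hepi hn using fun k : ℕ =>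
    exists_approximate_multipliers hC A B hx₀ hA hc L.coe_nonneg hr hf' hmin (hδ k)
  have hlim : Tendsto (fun k : ℕ => (1 : ℝ) / (k + 1)) atTop (𝓝 0) :=
    tendsto_one_div_add_atTop_nhds_zero_nat
  have hx' : Tendsto x atTop (𝓝 x₀) := tendsto_iff_norm_sub_tendsto_zero.2
    (squeeze_zero (fun _ => norm_nonneg _) (fun k => (hx k).le) hlim)
  have hz' : Tendsto z atTop (𝓝 (B x₀)) := tendsto_iff_norm_sub_tendsto_zero.2
    (squeeze_zero (fun _ => norm_nonneg _) (fun k => (hz k).le) hlim)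
  have hfz' : Tendsto (fun k => f (z k)) atTop (𝓝 (f (B x₀))) :=
    (hf.continuous.tendsto _).comp hz'
  obtain ⟨⟨ξ₀, η₀⟩, -, φ, hφ, hφlim⟩ :=
    ((isCompact_closedBall (0 : Z) (2 * L)).prod (isCompact_closedBall (0 : Y) c)).tendsto_subseq
      (x := fun k => (ξ k, η k)) fun k => ⟨by simpa using hξ k, by simpa using hη k⟩
  have hξφ : Tendsto (fun k => ξ (φ k)) atTop (𝓝 ξ₀) := (continuous_fst.tendsto _).comp hφlim
  have hηφ : Tendsto (fun k => η (φ k)) atTop (𝓝 η₀) := (continuous_snd.tendsto _).comp hφlim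
  have hφt := hφ.tendsto_atTop
  refine ⟨ξ₀, ⟨fun k => pair (z (φ k)) (f (z (φ k))), fun k => pair (ξ (φ k)) (-1),
    fun k => le_refl (f (z (φ k))), ?_, ?_, fun k => hepi (φ k)⟩, η₀,
    -(B.adjoint ξ₀ + A.adjoint η₀ + (x₀ - x₀)),
    ⟨fun k => x (φ k), fun k => -(B.adjoint (ξ (φ k)) + A.adjoint (η (φ k)) + (x (φ k) - x₀)),
      fun k => hxC _, hx'.comp hφt, ?_, fun k => hn (φ k)⟩, fun d => ?_⟩
  · exact ((WithLp.prod_continuous_toLp 2 Z ℝ).tendsto _).comp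
      ((hz'.comp hφt).prodMk_nhds (hfz'.comp hφt))
  · exact ((WithLp.prod_continuous_toLp 2 Z ℝ).tendsto _).comp
      (hξφ.prodMk_nhds tendsto_const_nhds)
  · exact (((((B.adjoint).continuous.tendsto _).comp hξφ).add
      (((A.adjoint).continuous.tendsto _).comp hηφ)).add ((hx'.comp hφt).sub_const x₀)).neg
  · rw [sub_self, add_zero, inner_neg_left, inner_add_left,
        ContinuousLinearMap.adjoint_inner_left, ContinuousLinearMap.adjoint_inner_left]

/-- Exact penalization: if `‖A x‖` bounds the distance of `B x` to `S` for the points `x` of `C`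
near `x₀`, then a local minimizer of `f` on `S` satisfies a multiplier rule on `C`. The distance is
expressed by points of `S` that attain it up to any `ε > 0`. -/
theorem exists_multipliers_of_errorBound [FiniteDimensional ℝ X] [FiniteDimensional ℝ Y]
    [FiniteDimensional ℝ Z] {f : Z → ℝ} (hf : LocallyLipschitz f) {C : Set X} (hC : IsClosed C)
    (A : X →L[ℝ] Y) (B : X →L[ℝ] Z) {x₀ : X} (hx₀ : x₀ ∈ C) (hA : A x₀ = 0)
    {S : Set Z} (hmin : IsLocalMinOn f S (B x₀)) {κ : ℝ} (hκ : 0 ≤ κ)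
    (hS : ∀ᶠ x in 𝓝[C] x₀, ∀ ε > 0, ∃ s ∈ S, ‖B x - s‖ ≤ κ * ‖A x‖ + ε) :
    ∃ ξ ∈ limitingSubdifferential f (B x₀), ∃ η : Y, ∃ n ∈ limitingNormalCone C x₀,
      ∀ d, inner ℝ n d = -(inner ℝ ξ (B d) + inner ℝ η (A d)) := by
  obtain ⟨L, t, ht, hL⟩ := hf (B x₀)
  refine exists_multipliers_of_isLocalMinOn hf hC A B hx₀ hA (c := L * κ) (by positivity) ?_
  obtain ⟨r, hr, hrt⟩ := Metric.nhds_basis_ball.mem_iff.1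
    (inter_mem ht (eventually_nhdsWithin_iff.1 hmin))
  have h1 : ∀ᶠ x in 𝓝[C] x₀, ‖B x - B x₀‖ + κ * ‖A x‖ < r := by
    refine nhdsWithin_le_nhds (((show Continuous fun x => ‖B x - B x₀‖ + κ * ‖A x‖ by
      fun_prop).tendsto x₀).eventually_lt_const (by simpa [hA] using hr))
  filter_upwards [hS, h1] with x hx hxr
  simp only [hA, norm_zero, mul_zero, add_zero]
  have hAx : 0 ≤ κ * ‖A x‖ := by positivity
  have key : ∀ ε > 0, ε < r - (‖B x - B x₀‖ + κ * ‖A x‖) →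
      f (B x₀) ≤ f (B x) + L * (κ * ‖A x‖ + ε) := by
    intro ε hε hεr
    obtain ⟨s, hs, hsx⟩ := hx ε hε
    have hsb : s ∈ Metric.ball (B x₀) r := by
      rw [Metric.mem_ball, dist_eq_norm]
      have := norm_sub_le_norm_sub_add_norm_sub s (B x) (B x₀)
      rw [norm_sub_rev s (B x)] at this
      linarith
    have hxb : B x ∈ Metric.ball (B x₀) r := by
      rw [Metric.mem_ball, dist_eq_norm]; linarith
    have h2 : f (B x₀) ≤ f s := (hrt hsb).2 hs
    have h3 := hL.dist_le_mul _ (hrt hsb).1 _ (hrt hxb).1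
    rw [Real.dist_eq, dist_eq_norm, norm_sub_rev] at h3
    have h4 := mul_le_mul_of_nonneg_left hsx L.coe_nonneg
    linarith [le_abs_self (f s - f (B x))]
  have hlim : Tendsto (fun ε : ℝ => f (B x) + L * (κ * ‖A x‖ + ε)) (𝓝[>] 0)
      (𝓝 (f (B x) + L * (κ * ‖A x‖ + 0))) :=
    (Continuous.tendsto (by fun_prop) 0).mono_left nhdsWithin_le_nhds
  have := ge_of_tendsto hlim (by
    filter_upwards [self_mem_nhdsWithin, Ioo_mem_nhdsGT (sub_pos.2 hxr)] with ε h5 h6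
    exact key ε h5 h6.2)
  linarith

end Calculus

section Products

/-! ### Euclidean products and metric subregularity -/

variable {E F : Type*} [NormedAddCommGroup E] [NormedAddCommGroup F]

theorem norm_pair_le (x : E) (y : F) : ‖pair x y‖ ≤ ‖x‖ + ‖y‖ := by
  rw [WithLp.prod_norm_eq_of_L2]
  refine Real.sqrt_le_iff.2 ⟨by positivity, ?_⟩
  simp only [WithLp.toLp_fst, WithLp.toLp_snd]
  nlinarith [norm_nonneg x, norm_nonneg y]

theorem norm_fst_le_norm (p : Prod2 E F) : ‖p.fst‖ ≤ ‖p‖ := WithLp.norm_fst_le _ p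

theorem norm_snd_le_norm (p : Prod2 E F) : ‖p.snd‖ ≤ ‖p‖ := WithLp.norm_snd_le _ p

theorem mem_sub_singleton_iff {A : Set E} {a b : E} : b ∈ A - {a} ↔ b + a ∈ A := by
  simp [Set.sub_singleton, sub_eq_iff_eq_add]

theorem mem_singleton_sub_iff {A : Set E} {a b : E} : b ∈ {a} - A ↔ a - b ∈ A := by
  simp only [Set.singleton_sub, mem_image]
  constructor
  · rintro ⟨x, hx, rfl⟩
    simpa using hx
  · exact fun h => ⟨_, h, by simp⟩

theorem isClosed_setProd {A : Set E} {B : Set F} (hA : IsClosed A) (hB : IsClosed B) :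
    IsClosed (setProd A B) :=
  (hA.preimage (WithLp.continuous_fst 2 E F)).inter (hB.preimage (WithLp.continuous_snd 2 E F))

/-- Metric subregularity without extended distances: near `z₀`, any `w ∈ S z` gives a solution of
`w₀ ∈ S x` whose distance to `z` exceeds `κ * ‖w - w₀‖` by as little as desired. -/
theorem MetricallySubregularAt.exists_eventually {S : E → Set F} {z₀ : E} {w₀ : F}
    (h : MetricallySubregularAt S z₀ w₀) :
    ∃ κ : ℝ, 0 ≤ κ ∧ ∀ᶠ z in 𝓝 z₀, ∀ w ∈ S z, ∀ ε > 0,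
      ∃ x, w₀ ∈ S x ∧ ‖z - x‖ ≤ κ * ‖w - w₀‖ + ε := by
  obtain ⟨κ, hκ, U, hU, h⟩ := h
  refine ⟨κ, hκ.le, ?_⟩
  filter_upwards [hU] with z hz w hw ε hε
  have h1 : Metric.infEDist z {x | w₀ ∈ S x} < ENNReal.ofReal (κ * ‖w - w₀‖ + ε) := by
    refine (h z hz).trans_lt ?_
    calc ENNReal.ofReal κ * Metric.infEDist w₀ (S z)
        ≤ ENNReal.ofReal κ * ENNReal.ofReal ‖w - w₀‖ := by
          gcongr
          rw [← dist_eq_norm, ← edist_dist, edist_comm]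
          exact Metric.infEDist_le_edist_of_mem hw
      _ = ENNReal.ofReal (κ * ‖w - w₀‖) := (ENNReal.ofReal_mul hκ.le).symm
      _ < _ := (ENNReal.ofReal_lt_ofReal_iff (by positivity)).2 (by linarith)
  obtain ⟨x, hx, hzx⟩ := Metric.infEDist_lt_iff.1 h1
  rw [edist_dist, ENNReal.ofReal_lt_ofReal_iff (by positivity), dist_eq_norm] at hzx
  exact ⟨x, hx, hzx.le⟩

end Products

section LinearMaps

variable {X E F : Type*} [NormedAddCommGroup X] [InnerProductSpace ℝ X]
  [NormedAddCommGroup E] [InnerProductSpace ℝ E] [NormedAddCommGroup F] [InnerProductSpace ℝ F]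

/-- The continuous linear map `x ↦ (f x, g x)` into the Euclidean product. -/
noncomputable def pairL (f : X →L[ℝ] E) (g : X →L[ℝ] F) : X →L[ℝ] Prod2 E F :=
  (WithLp.prodContinuousLinearEquiv 2 ℝ E F).symm.toContinuousLinearMap ∘L f.prod g

@[simp]
theorem pairL_apply (f : X →L[ℝ] E) (g : X →L[ℝ] F) (x : X) :
    pairL f g x = pair (f x) (g x) := rfl

end LinearMaps

/-! ### Error bounds for the feasible set -/

theorem mem_mapH_of_mem {Z L W : Type*} {F : Z → Set L} {G : Prod2 Z L → Set W} {z : Z} {w : W}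
    {l : L} (hl : l ∈ F z) (hw : w ∈ G (pair z l)) : w ∈ mapH F G z :=
  mem_iUnion₂.2 ⟨l, hl, hw⟩

theorem mem_mapCalH_iff {Z L W : Type*} [NormedAddCommGroup L] {F : Z → Set L}
    {G : Prod2 Z L → Set W} {p : Prod2 Z L} {q : Prod2 L W} :
    q ∈ mapCalH F G p ↔ q.fst + p.snd ∈ F p.fst ∧ q.snd ∈ G p := by
  rw [← mem_sub_singleton_iff]; rfl

/-- Metric subregularity of `H_M` turns approximate solutions `(z', w')` of `w ∈ H(z)` into an
error bound for the feasible set. Here `m x` is a point of `M` and `r x` the residual in `W`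
attached to `x`, both controlled by `A x`. -/
theorem errorBound_of_metricallySubregularAt_mapHM
    {X Y Z L W : Type*} [NormedAddCommGroup X] [InnerProductSpace ℝ X]
    [NormedAddCommGroup Y] [InnerProductSpace ℝ Y] [NormedAddCommGroup Z] [InnerProductSpace ℝ Z]
    [NormedAddCommGroup W] [InnerProductSpace ℝ W] {F : Z → Set L} {G : Prod2 Z L → Set W}
    {M : Set Z} {z₀ : Z}
    (hH : MetricallySubregularAt (mapHM F G M) z₀ 0) {C : Set X}
    (A : X →L[ℝ] Y) (B : X →L[ℝ] Z) {x₀ : X} (hA : A x₀ = 0) (hB : B x₀ = z₀)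
    {m : X → Z} {r : X → W} (hm : ∀ x ∈ C, m x ∈ M) (hmA : ∀ x, ‖B x - m x‖ ≤ ‖A x‖)
    (hrA : ∀ x, ‖r x‖ ≤ ‖A x‖) {κ : ℝ} (hκ : 0 ≤ κ)
    (h : ∀ᶠ x in 𝓝[C] x₀, ∀ ε > 0, ∃ z', ∃ w' ∈ mapH F G z',
      ‖B x - z'‖ ≤ κ * ‖A x‖ + ε ∧ ‖r x - w'‖ ≤ κ * ‖A x‖ + ε) :
    ∃ κ' : ℝ, 0 ≤ κ' ∧ ∀ᶠ x in 𝓝[C] x₀, ∀ ε > 0,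
      ∃ s ∈ feasibleSet F G M, ‖B x - s‖ ≤ κ' * ‖A x‖ + ε := by
  obtain ⟨κ₁, hκ₁, h₁⟩ := hH.exists_eventually
  obtain ⟨ρ, hρ, h₁⟩ := Metric.eventually_nhds_iff.1 h₁
  refine ⟨κ + 2 * κ₁ * (κ + 1), by positivity, ?_⟩
  have h2 : ∀ᶠ x in 𝓝[C] x₀, ‖B x - z₀‖ + κ * ‖A x‖ < ρ :=
    nhdsWithin_le_nhds (((show Continuous fun x => ‖B x - z₀‖ + κ * ‖A x‖ by
      fun_prop).tendsto x₀).eventually_lt_const (by simpa [hA, hB] using hρ))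
  filter_upwards [h, h2, self_mem_nhdsWithin] with x hx hxρ hxC ε hε
  -- `ε'` keeps `z'` in the neighborhood of subregularity and absorbs the slack of all estimates
  obtain ⟨ε', hε', hε'ρ, hε'ε⟩ : ∃ ε' > 0, ε' < ρ - (‖B x - z₀‖ + κ * ‖A x‖) ∧
      (2 * κ₁ + 2) * ε' ≤ ε := by
    refine ⟨min ((ρ - (‖B x - z₀‖ + κ * ‖A x‖)) / 2) (ε / (2 * κ₁ + 2)), ?_, ?_, ?_⟩
    · exact lt_min (half_pos (sub_pos.2 hxρ)) (by positivity)
    · exact (min_le_left _ _).trans_lt (half_lt_self (sub_pos.2 hxρ))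
    · rw [mul_comm, ← le_div_iff₀ (by positivity)]
      exact min_le_right _ _
  obtain ⟨z', w', hw', hz', hrw⟩ := hx ε' hε'
  have hz'ρ : dist z' z₀ < ρ := by
    rw [dist_eq_norm]
    have := norm_sub_le_norm_sub_add_norm_sub z' (B x) z₀
    rw [norm_sub_rev z' (B x)] at this
    linarith
  obtain ⟨s, hs, hzs⟩ := h₁ hz'ρ (pair w' (z' - m x))
    ⟨hw', mem_singleton_sub_iff.2 (by simpa using hm x hxC)⟩ ε' hε'
  refine ⟨s, ⟨hs.1, by simpa using mem_singleton_sub_iff.1 hs.2⟩, ?_⟩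
  have e1 : ‖w'‖ ≤ (κ + 1) * ‖A x‖ + ε' := by
    have := norm_le_norm_add_norm_sub (r x) w'
    linarith [hrA x]
  have e2 : ‖z' - m x‖ ≤ (κ + 1) * ‖A x‖ + ε' := by
    have := norm_sub_le_norm_sub_add_norm_sub z' (B x) (m x)
    rw [norm_sub_rev z' (B x)] at this
    linarith [hmA x]
  have e3 : ‖z' - s‖ ≤ κ₁ * (2 * ((κ + 1) * ‖A x‖ + ε')) + ε' := by
    rw [sub_zero] at hzs
    refine hzs.trans (add_le_add_left (mul_le_mul_of_nonneg_left ?_ hκ₁) _)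
    linarith [norm_pair_le w' (z' - m x)]
  have e4 := norm_sub_le_norm_sub_add_norm_sub (B x) z' s
  linarith

section Stationarity

variable {Z L W : Type*} [NormedAddCommGroup Z] [InnerProductSpace ℝ Z]
  [NormedAddCommGroup L] [InnerProductSpace ℝ L] [NormedAddCommGroup W] [InnerProductSpace ℝ W]
  {F : Z → Set L} {G : Prod2 Z L → Set W} {M : Set Z} {f : Z → ℝ} {z₀ : Z} {l : L}

theorem isClosed_gph_mapCalH (hF : IsClosed (gph F)) (hG : IsClosed (gph G)) :
    IsClosed (gph (mapCalH F G)) := by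
  have h : gph (mapCalH F G) =
      {p | pair p.fst.fst (p.snd.fst + p.fst.snd) ∈ gph F ∧ pair p.fst p.snd.snd ∈ gph G} := by
    ext p
    exact mem_mapCalH_iff
  rw [h]
  refine (hF.preimage ?_).inter (hG.preimage ?_)
  · exact (pairL (WithLp.fstL 2 ℝ Z L ∘L WithLp.fstL 2 ℝ _ _)
      (WithLp.fstL 2 ℝ L W ∘L WithLp.sndL 2 ℝ _ _ +
        WithLp.sndL 2 ℝ Z L ∘L WithLp.fstL 2 ℝ _ _)).continuous
  · exact (pairL (WithLp.fstL 2 ℝ (Prod2 Z L) (Prod2 L W))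
      (WithLp.sndL 2 ℝ L W ∘L WithLp.sndL 2 ℝ _ _)).continuous

/-! ### Multipliers from the graph of `𝓗` -/

/-- The decision component of the points `((z, l), (u, v), m)`, where `(u, v) ∈ 𝓗(z, l)` and
`m ∈ M`. -/
noncomputable def calHDecision (Z L W : Type*) [NormedAddCommGroup Z] [InnerProductSpace ℝ Z]
    [NormedAddCommGroup L] [InnerProductSpace ℝ L] [NormedAddCommGroup W] [InnerProductSpace ℝ W] :
    Prod2 (Prod2 (Prod2 Z L) (Prod2 L W)) Z →L[ℝ] Z :=
  WithLp.fstL 2 ℝ Z L ∘L WithLp.fstL 2 ℝ _ _ ∘L WithLp.fstL 2 ℝ _ _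

/-- The residual `((u, v), z - m)` of the points `((z, l), (u, v), m)`, where `(u, v) ∈ 𝓗(z, l)`
and `m ∈ M`. It is the element of `𝓗_M(z, l)` determined by `(u, v)` and `m`. -/
noncomputable def calHResidual (Z L W : Type*) [NormedAddCommGroup Z] [InnerProductSpace ℝ Z]
    [NormedAddCommGroup L] [InnerProductSpace ℝ L] [NormedAddCommGroup W] [InnerProductSpace ℝ W] :
    Prod2 (Prod2 (Prod2 Z L) (Prod2 L W)) Z →L[ℝ] Prod2 (Prod2 L W) Z :=
  pairL (WithLp.sndL 2 ℝ _ _ ∘L WithLp.fstL 2 ℝ _ _)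
    (calHDecision Z L W - WithLp.sndL 2 ℝ _ _)

@[simp]
theorem calHDecision_apply (x : Prod2 (Prod2 (Prod2 Z L) (Prod2 L W)) Z) :
    calHDecision Z L W x = x.fst.fst.fst := rfl

@[simp]
theorem calHResidual_apply (x : Prod2 (Prod2 (Prod2 Z L) (Prod2 L W)) Z) :
    calHResidual Z L W x = pair x.fst.snd (x.fst.fst.fst - x.snd) := rfl

/-- If the residuals `u`, `v`, `z - m` bound the distance of `z` to the feasible set, the multiplier
rule gives a normal to `gph 𝓗` whose `l`-component vanishes; the inclusion `Inc` splits it into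
coderivatives of `F` and `G` with a common multiplier. -/
theorem explicitlyMStationary_of_errorBound_calH [FiniteDimensional ℝ Z] [FiniteDimensional ℝ L]
    [FiniteDimensional ℝ W] (hf : LocallyLipschitz f) (hF : IsClosed (gph F))
    (hG : IsClosed (gph G)) (hM : IsClosed M) (hz : IsLocalMinimizer f F G M z₀)
    (hl : l ∈ mapK F G z₀) (hInc : Inc F G z₀ l) {κ : ℝ} (hκ : 0 ≤ κ)
    (h : ∀ᶠ x in 𝓝[setProd (gph (mapCalH F G)) M] (pair (pair (pair z₀ l) 0) z₀), ∀ ε > 0,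
      ∃ s ∈ feasibleSet F G M,
        ‖calHDecision Z L W x - s‖ ≤ κ * ‖calHResidual Z L W x‖ + ε) :
    ExplicitlyMStationary f F G M z₀ := by
  obtain ⟨ξ, hξ, η, n, hn, hd⟩ := exists_multipliers_of_errorBound hf
    (isClosed_setProd (isClosed_gph_mapCalH hF hG) hM) (calHResidual Z L W) (calHDecision Z L W)
    (x₀ := pair (pair (pair z₀ l) 0) z₀)
    ⟨mem_mapCalH_iff.2 ⟨by simpa using hl.1, hl.2⟩, hz.1.2⟩
    (by apply WithLp.ofLp_injective; simp) hz.2 hκ h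
  have hn' : n = pair (pair (pair (-(ξ + η.snd)) 0) (-η.fst)) η.snd := by
    refine ext_inner_right ℝ fun d => ?_
    rw [hd]
    simp [WithLp.prod_inner_apply, inner_add_left, inner_sub_right]
    ring
  obtain ⟨h1, h2⟩ := limitingNormalCone_setProd_subset hn
  rw [hn'] at h1 h2
  obtain ⟨a, ⟨ha1, ha2⟩, b, hb, hab⟩ := mem_add.1 (hInc η.fst.fst η.fst.snd h1)
  have hb2 : b.snd = η.fst.fst := by
    have := congrArg WithLp.snd hab
    rw [WithLp.add_snd, mem_singleton_iff.1 ha2] at this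
    have h0 : -η.fst.fst + b.snd = 0 := by simpa using this
    exact (neg_add_eq_zero.1 h0).symm
  have hb1 : a.fst + b.fst = -(ξ + η.snd) := congrArg WithLp.fst hab
  refine ⟨l, hl, η.fst.fst, η.fst.snd, mem_add.2 ⟨ξ + a.fst + b.fst, ?_, η.snd, h2, ?_⟩⟩
  · refine add_mem_add (add_mem_add hξ ha1) ?_
    rw [← hb2]
    exact hb
  · rw [add_assoc ξ, hb1]; abel

/-! ### Multipliers from the graphs of `F` and `G` -/

/-- The decision component of the points `(a, (b, w), m)`, where `a ∈ gph F`, `(b, w) ∈ gph G` and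
`m ∈ M`. -/
noncomputable def graphDecision (Z L W : Type*) [NormedAddCommGroup Z] [InnerProductSpace ℝ Z]
    [NormedAddCommGroup L] [InnerProductSpace ℝ L] [NormedAddCommGroup W] [InnerProductSpace ℝ W] :
    Prod2 (Prod2 (Prod2 Z L) (Prod2 (Prod2 Z L) W)) Z →L[ℝ] Z :=
  WithLp.fstL 2 ℝ Z L ∘L WithLp.fstL 2 ℝ _ _ ∘L WithLp.fstL 2 ℝ _ _

/-- The residual `((a - b, w), a.fst - m)` of the points `(a, (b, w), m)`, where `a ∈ gph F`,
`(b, w) ∈ gph G` and `m ∈ M`. -/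
noncomputable def graphResidual (Z L W : Type*) [NormedAddCommGroup Z] [InnerProductSpace ℝ Z]
    [NormedAddCommGroup L] [InnerProductSpace ℝ L] [NormedAddCommGroup W] [InnerProductSpace ℝ W] :
    Prod2 (Prod2 (Prod2 Z L) (Prod2 (Prod2 Z L) W)) Z →L[ℝ] Prod2 (Prod2 (Prod2 Z L) W) Z :=
  pairL (pairL (WithLp.fstL 2 ℝ (Prod2 Z L) (Prod2 (Prod2 Z L) W) ∘L WithLp.fstL 2 ℝ _ _ -
      WithLp.fstL 2 ℝ (Prod2 Z L) W ∘L WithLp.sndL 2 ℝ (Prod2 Z L) _ ∘L WithLp.fstL 2 ℝ _ _)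
      (WithLp.sndL 2 ℝ (Prod2 Z L) W ∘L WithLp.sndL 2 ℝ (Prod2 Z L) _ ∘L
        WithLp.fstL 2 ℝ _ _))
    (graphDecision Z L W - WithLp.sndL 2 ℝ _ _)

@[simp]
theorem graphDecision_apply (x : Prod2 (Prod2 (Prod2 Z L) (Prod2 (Prod2 Z L) W)) Z) :
    graphDecision Z L W x = x.fst.fst.fst := rfl

@[simp]
theorem graphResidual_apply (x : Prod2 (Prod2 (Prod2 Z L) (Prod2 (Prod2 Z L) W)) Z) :
    graphResidual Z L W x =
      pair (pair (x.fst.fst - x.fst.snd.fst) x.fst.snd.snd) (x.fst.fst.fst - x.snd) := rfl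

/-- If the residuals `a - b`, `w`, `a.fst - m` bound the distance of `a.fst` to the feasible set,
the multiplier rule gives normals to `gph F` and `gph G` separately, and no calculus for `𝓗` is
needed. -/
theorem explicitlyMStationary_of_errorBound_graph [FiniteDimensional ℝ Z] [FiniteDimensional ℝ L]
    [FiniteDimensional ℝ W] (hf : LocallyLipschitz f) (hF : IsClosed (gph F))
    (hG : IsClosed (gph G)) (hM : IsClosed M) (hz : IsLocalMinimizer f F G M z₀)
    (hl : l ∈ mapK F G z₀) {κ : ℝ} (hκ : 0 ≤ κ)
    (h : ∀ᶠ x in 𝓝[setProd (setProd (gph F) (gph G)) M]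
      (pair (pair (pair z₀ l) (pair (pair z₀ l) 0)) z₀), ∀ ε > 0,
      ∃ s ∈ feasibleSet F G M,
        ‖graphDecision Z L W x - s‖ ≤ κ * ‖graphResidual Z L W x‖ + ε) :
    ExplicitlyMStationary f F G M z₀ := by
  obtain ⟨ξ, hξ, η, n, hn, hd⟩ := exists_multipliers_of_errorBound hf
    (isClosed_setProd (isClosed_setProd hF hG) hM) (graphResidual Z L W) (graphDecision Z L W)
    (x₀ := pair (pair (pair z₀ l) (pair (pair z₀ l) 0)) z₀) ⟨⟨hl.1, hl.2⟩, hz.1.2⟩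
    (by apply WithLp.ofLp_injective; simp) hz.2 hκ h
  have hn' : n = pair (pair (pair (-(ξ + η.snd + η.fst.fst.fst)) (-η.fst.fst.snd))
      (pair (pair η.fst.fst.fst η.fst.fst.snd) (-η.fst.snd))) η.snd := by
    refine ext_inner_right ℝ fun d => ?_
    rw [hd]
    simp [WithLp.prod_inner_apply, inner_add_left, inner_sub_right]
    ring
  obtain ⟨h1, h2⟩ := limitingNormalCone_setProd_subset hn
  obtain ⟨h3, h4⟩ := limitingNormalCone_setProd_subset h1
  rw [hn'] at h2 h3 h4
  refine ⟨l, hl, η.fst.fst.snd, η.fst.snd, mem_add.2 ⟨_, add_mem_add (add_mem_add hξ h3) h4,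
    η.snd, h2, ?_⟩⟩
  abel

/-! ### The four constraint qualifications -/

/-- A pair `(u, v) ∈ 𝓗(z, l)` makes `(z, v, l)` an approximate zero of `Ĥ` with residual `(u, 0)`;
nearby zeros of `Ĥ` give points of `gph H`, to which subregularity of `H_M` applies. -/
theorem explicitlyMStationary_of_mapHHat [FiniteDimensional ℝ Z] [FiniteDimensional ℝ L]
    [FiniteDimensional ℝ W] (hf : LocallyLipschitz f) (hF : IsClosed (gph F))
    (hG : IsClosed (gph G)) (hM : IsClosed M) (hz : IsLocalMinimizer f F G M z₀)
    (hl : l ∈ mapK F G z₀) (hInc : Inc F G z₀ l)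
    (hHM : MetricallySubregularAt (mapHM F G M) z₀ 0)
    (hH : MetricallySubregularAt (mapHHat F G) (pair (pair z₀ 0) l) 0) :
    ExplicitlyMStationary f F G M z₀ := by
  obtain ⟨κ, hκ, h⟩ := hH.exists_eventually
  have hx : ∀ᶠ x in 𝓝[setProd (gph (mapCalH F G)) M] (pair (pair (pair z₀ l) 0) z₀), ∀ ε > 0,
      ∃ z', ∃ w' ∈ mapH F G z', ‖calHDecision Z L W x - z'‖ ≤ κ * ‖calHResidual Z L W x‖ + ε ∧
        ‖x.fst.snd.snd - w'‖ ≤ κ * ‖calHResidual Z L W x‖ + ε := by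
    -- `T ((z, l), (u, v), m) = ((z, v), l)`: choosing `w = v` leaves the residual `(u, 0)` in `Ĥ`
    let T : Prod2 (Prod2 (Prod2 Z L) (Prod2 L W)) Z →L[ℝ] Prod2 (Prod2 Z W) L :=
      pairL (pairL (calHDecision Z L W)
        (WithLp.sndL 2 ℝ L W ∘L WithLp.sndL 2 ℝ _ _ ∘L WithLp.fstL 2 ℝ _ _))
        (WithLp.sndL 2 ℝ Z L ∘L WithLp.fstL 2 ℝ _ _ ∘L WithLp.fstL 2 ℝ _ _)
    have hT := nhdsWithin_le_nhds (s := setProd (gph (mapCalH F G)) M)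
      ((T.continuous.tendsto (pair (pair (pair z₀ l) 0) z₀)).eventually h)
    filter_upwards [hT, self_mem_nhdsWithin] with x hx hxC ε hε
    obtain ⟨hxF, hxG⟩ := mem_mapCalH_iff.1 hxC.1
    obtain ⟨p, ⟨hp1, hp2⟩, hp⟩ := hx (pair x.fst.snd.fst 0)
      ⟨mem_sub_singleton_iff.2 hxF, mem_sub_singleton_iff.2 (by
        simp only [WithLp.toLp_snd, zero_add]; exact hxG)⟩ ε hε
    have hp' : ‖T x - p‖ ≤ κ * ‖calHResidual Z L W x‖ + ε := by
      refine hp.trans (add_le_add_left (mul_le_mul_of_nonneg_left ?_ hκ) _)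
      rw [sub_zero, WithLp.norm_toLp_fst]
      exact (norm_fst_le_norm x.fst.snd).trans (norm_fst_le_norm (calHResidual Z L W x))
    have hp3 := (norm_fst_le_norm (T x - p)).trans hp'
    refine ⟨p.fst.fst, p.fst.snd, mem_mapH_of_mem (l := p.snd) ?_ ?_,
      (norm_fst_le_norm (T x - p).fst).trans hp3, (norm_snd_le_norm (T x - p).fst).trans hp3⟩
    · simpa using mem_sub_singleton_iff.1 hp1
    · simpa using mem_sub_singleton_iff.1 hp2
  obtain ⟨κ', hκ', h'⟩ := errorBound_of_metricallySubregularAt_mapHM hHM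
    (C := setProd (gph (mapCalH F G)) M) (calHResidual Z L W) (calHDecision Z L W)
    (x₀ := pair (pair (pair z₀ l) 0) z₀) (by apply WithLp.ofLp_injective; simp) (by simp)
    (m := fun x => x.snd) (r := fun x => x.fst.snd.snd) (fun x hx => hx.2)
    (fun x => norm_snd_le_norm (calHResidual Z L W x))
    (fun x => (norm_snd_le_norm x.fst.snd).trans
      (norm_fst_le_norm (calHResidual Z L W x))) hκ hx
  exact explicitlyMStationary_of_errorBound_calH hf hF hG hM hz hl hInc hκ' h'

/-- The counterpart of `explicitlyMStationary_of_mapHHat` in which the graphs of `F` and `G` are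
decoupled. -/
theorem explicitlyMStationary_of_mapHTilde [FiniteDimensional ℝ Z] [FiniteDimensional ℝ L]
    [FiniteDimensional ℝ W] (hf : LocallyLipschitz f) (hF : IsClosed (gph F))
    (hG : IsClosed (gph G)) (hM : IsClosed M) (hz : IsLocalMinimizer f F G M z₀)
    (hl : l ∈ mapK F G z₀) (hHM : MetricallySubregularAt (mapHM F G M) z₀ 0)
    (hH : MetricallySubregularAt (mapHTilde F G) (pair (pair z₀ 0) (pair z₀ l)) 0) :
    ExplicitlyMStationary f F G M z₀ := by
  obtain ⟨κ, hκ, h⟩ := hH.exists_eventually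
  have hx : ∀ᶠ x in 𝓝[setProd (setProd (gph F) (gph G)) M]
      (pair (pair (pair z₀ l) (pair (pair z₀ l) 0)) z₀), ∀ ε > 0,
      ∃ z', ∃ w' ∈ mapH F G z', ‖graphDecision Z L W x - z'‖ ≤ 2 * κ * ‖graphResidual Z L W x‖ + ε ∧
        ‖x.fst.snd.snd - w'‖ ≤ 2 * κ * ‖graphResidual Z L W x‖ + ε := by
    -- for `a = (z, l) ∈ gph F` and `(b, w) ∈ gph G` with `b = (q, l')`, the residual of
    -- `((z, w), b)` is `(z - q, (l - l', 0))`
    let T : Prod2 (Prod2 (Prod2 Z L) (Prod2 (Prod2 Z L) W)) Z →L[ℝ] Prod2 (Prod2 Z W) (Prod2 Z L) :=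
      pairL (pairL (graphDecision Z L W)
        (WithLp.sndL 2 ℝ _ W ∘L WithLp.sndL 2 ℝ _ _ ∘L WithLp.fstL 2 ℝ _ _))
        (WithLp.fstL 2 ℝ _ W ∘L WithLp.sndL 2 ℝ _ _ ∘L WithLp.fstL 2 ℝ _ _)
    have hT := nhdsWithin_le_nhds (s := setProd (setProd (gph F) (gph G)) M)
      ((T.continuous.tendsto (pair (pair (pair z₀ l) (pair (pair z₀ l) 0)) z₀)).eventually h)
    filter_upwards [hT, self_mem_nhdsWithin] with x hx hxC ε hε
    obtain ⟨p, ⟨hp0, hp1, hp2⟩, hp⟩ := hx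
      (pair (x.fst.fst.fst - x.fst.snd.fst.fst) (pair (x.fst.fst.snd - x.fst.snd.fst.snd) 0))
      ⟨rfl, mem_sub_singleton_iff.2 (by
        change x.fst.fst.snd - x.fst.snd.fst.snd + x.fst.snd.fst.snd ∈ F x.fst.fst.fst
        rw [sub_add_cancel]; exact hxC.1.1), mem_sub_singleton_iff.2 (by
        simp only [WithLp.toLp_snd, zero_add]; exact hxC.1.2)⟩ ε hε
    have hp' : ‖T x - p‖ ≤ 2 * κ * ‖graphResidual Z L W x‖ + ε := by
      have e0 := (norm_fst_le_norm (graphResidual Z L W x).fst).trans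
        (norm_fst_le_norm (graphResidual Z L W x))
      have e1 := (norm_fst_le_norm (graphResidual Z L W x).fst.fst).trans e0
      have e2 := (norm_snd_le_norm (graphResidual Z L W x).fst.fst).trans e0
      refine hp.trans (add_le_add_left ?_ _)
      rw [mul_right_comm, mul_comm _ κ, sub_zero]
      refine mul_le_mul_of_nonneg_left ((norm_pair_le _ _).trans ?_) hκ
      rw [WithLp.norm_toLp_fst, two_mul]
      exact add_le_add e1 e2
    have hp3 := (norm_fst_le_norm (T x - p)).trans hp'
    have hp4 : p.fst.fst = p.snd.fst := (sub_eq_zero.1 (mem_singleton_iff.1 hp0).symm)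
    refine ⟨p.fst.fst, p.fst.snd, mem_mapH_of_mem (l := p.snd.snd) ?_ ?_,
      (norm_fst_le_norm (T x - p).fst).trans hp3, (norm_snd_le_norm (T x - p).fst).trans hp3⟩
    · simpa using mem_sub_singleton_iff.1 hp1
    · rw [hp4]
      have := mem_sub_singleton_iff.1 hp2
      rwa [WithLp.zero_snd, WithLp.zero_snd, zero_add] at this
  obtain ⟨κ', hκ', h'⟩ := errorBound_of_metricallySubregularAt_mapHM hHM
    (C := setProd (setProd (gph F) (gph G)) M) (graphResidual Z L W) (graphDecision Z L W)
    (x₀ := pair (pair (pair z₀ l) (pair (pair z₀ l) 0)) z₀)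
    (by apply WithLp.ofLp_injective; simp) (by simp)
    (m := fun x => x.snd) (r := fun x => x.fst.snd.snd) (fun x hx => hx.2)
    (fun x => norm_snd_le_norm (graphResidual Z L W x))
    (fun x => (norm_snd_le_norm (graphResidual Z L W x).fst).trans
      (norm_fst_le_norm (graphResidual Z L W x))) (κ := 2 * κ) (by positivity) hx
  exact explicitlyMStationary_of_errorBound_graph hf hF hG hM hz hl hκ' h'

theorem explicitlyMStationary_of_mapCalHM [FiniteDimensional ℝ Z] [FiniteDimensional ℝ L]
    [FiniteDimensional ℝ W] (hf : LocallyLipschitz f) (hF : IsClosed (gph F))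
    (hG : IsClosed (gph G)) (hM : IsClosed M) (hz : IsLocalMinimizer f F G M z₀)
    (hl : l ∈ mapK F G z₀) (hInc : Inc F G z₀ l)
    (hH : MetricallySubregularAt (mapCalHM F G M) (pair z₀ l) 0) :
    ExplicitlyMStationary f F G M z₀ := by
  obtain ⟨κ, hκ, h⟩ := hH.exists_eventually
  refine explicitlyMStationary_of_errorBound_calH hf hF hG hM hz hl hInc hκ ?_
  have hT := nhdsWithin_le_nhds (s := setProd (gph (mapCalH F G)) M)
    (((WithLp.fstL 2 ℝ (Prod2 Z L) (Prod2 L W) ∘L WithLp.fstL 2 ℝ _ Z).continuous.tendsto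
      (pair (pair (pair z₀ l) 0) z₀)).eventually h)
  filter_upwards [hT, self_mem_nhdsWithin] with x hx hxC ε hε
  obtain ⟨p, ⟨hp1, hp2⟩, hp⟩ := hx (calHResidual Z L W x)
    ⟨hxC.1, mem_singleton_sub_iff.2 (by simpa using hxC.2)⟩ ε hε
  rw [sub_zero] at hp
  obtain ⟨hp3, hp4⟩ := mem_mapCalH_iff.1 hp1
  exact ⟨p.fst, ⟨mem_mapH_of_mem (l := p.snd) (by simpa using hp3) hp4,
    by simpa using mem_singleton_sub_iff.1 hp2⟩, (norm_fst_le_norm (_ - p)).trans hp⟩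

theorem explicitlyMStationary_of_mapFrakHM [FiniteDimensional ℝ Z] [FiniteDimensional ℝ L]
    [FiniteDimensional ℝ W] (hf : LocallyLipschitz f) (hF : IsClosed (gph F))
    (hG : IsClosed (gph G)) (hM : IsClosed M) (hz : IsLocalMinimizer f F G M z₀)
    (hl : l ∈ mapK F G z₀) (hH : MetricallySubregularAt (mapFrakHM F G M) (pair z₀ l) 0) :
    ExplicitlyMStationary f F G M z₀ := by
  obtain ⟨κ, hκ, h⟩ := hH.exists_eventually
  refine explicitlyMStationary_of_errorBound_graph hf hF hG hM hz hl (κ := 3 * κ) (by positivity) ?_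
  have hT := nhdsWithin_le_nhds (s := setProd (setProd (gph F) (gph G)) M)
    (((WithLp.fstL 2 ℝ (Prod2 Z L) (Prod2 (Prod2 Z L) W) ∘L WithLp.fstL 2 ℝ _ Z).continuous.tendsto
      (pair (pair (pair z₀ l) (pair (pair z₀ l) 0)) z₀)).eventually h)
  filter_upwards [hT, self_mem_nhdsWithin] with x hx hxC ε hε
  obtain ⟨p, ⟨⟨hp1, hp2⟩, hp3⟩, hp⟩ := hx
    (pair (pair 0 (pair x.fst.fst 0 - x.fst.snd)) (x.fst.fst.fst - x.snd))
    ⟨⟨mem_singleton_sub_iff.2 (by simpa using hxC.1.1), mem_singleton_sub_iff.2 (by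
      simpa using hxC.1.2)⟩, mem_singleton_sub_iff.2 (by simpa using hxC.2)⟩ ε hε
  have hp1' : p ∈ gph F := by simpa using mem_singleton_sub_iff.1 hp1
  have hp2' : pair p (0 : W) ∈ gph G := by simpa using mem_singleton_sub_iff.1 hp2
  refine ⟨p.fst, ⟨mem_mapH_of_mem (l := p.snd) hp1' hp2',
    by simpa using mem_singleton_sub_iff.1 hp3⟩, (norm_fst_le_norm (_ - p)).trans (hp.trans ?_)⟩
  rw [sub_zero]
  have e0 := norm_fst_le_norm (graphResidual Z L W x)
  have e1 := (norm_fst_le_norm (graphResidual Z L W x).fst).trans e0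
  have e2 := (norm_snd_le_norm (graphResidual Z L W x).fst).trans e0
  have e3 := norm_snd_le_norm (graphResidual Z L W x)
  have e4 : ‖pair x.fst.fst (0 : W) - x.fst.snd‖ ≤
      ‖x.fst.fst - x.fst.snd.fst‖ + ‖x.fst.snd.snd‖ := by
    have := norm_pair_le (x.fst.fst - x.fst.snd.fst) (0 - x.fst.snd.snd)
    rwa [zero_sub, norm_neg, ← zero_sub] at this
  have e5 := norm_pair_le (pair (0 : Prod2 Z L) (pair x.fst.fst (0 : W) - x.fst.snd))
    (x.fst.fst.fst - x.snd)
  rw [WithLp.norm_toLp_snd] at e5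
  simp only [graphResidual_apply, WithLp.toLp_fst, WithLp.toLp_snd] at e1 e2 e3 ⊢
  refine add_le_add_left ?_ _
  rw [mul_right_comm, mul_comm _ κ]
  exact mul_le_mul_of_nonneg_left (by linarith) hκ

end Stationarity

end ImplicitVar

theorem theorem4p16 (n m s : ℕ)
    (f : EuclideanSpace ℝ (Fin n) → ℝ) (hf : LocallyLipschitz f)
    (F : EuclideanSpace ℝ (Fin n) → Set (EuclideanSpace ℝ (Fin m)))
    (G : ImplicitVar.Prod2 (EuclideanSpace ℝ (Fin n)) (EuclideanSpace ℝ (Fin m)) →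
      Set (EuclideanSpace ℝ (Fin s)))
    (hF : IsClosed (ImplicitVar.gph F)) (hG : IsClosed (ImplicitVar.gph G))
    (M : Set (EuclideanSpace ℝ (Fin n))) (hM : IsClosed M)
    (zbar : EuclideanSpace ℝ (Fin n)) (hz : ImplicitVar.IsLocalMinimizer f F G M zbar) :
    -- (a)
    ((ImplicitVar.MetricallySubregularAt (ImplicitVar.mapHM F G M) zbar 0 ∧
        ImplicitVar.InnerSemicompactAt (ImplicitVar.mapKHat F G) (ImplicitVar.pair zbar 0)
          (ImplicitVar.dom (ImplicitVar.mapKHat F G)) ∧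
        ∀ l ∈ ImplicitVar.mapK F G zbar,
          ImplicitVar.MetricallySubregularAt (ImplicitVar.mapHHat F G)
            (ImplicitVar.pair (ImplicitVar.pair zbar 0) l) 0 ∧
          ImplicitVar.Inc F G zbar l) →
      ImplicitVar.ExplicitlyMStationary f F G M zbar) ∧
    -- (b)
    ((ImplicitVar.MetricallySubregularAt (ImplicitVar.mapHM F G M) zbar 0 ∧
        ImplicitVar.InnerSemicompactAt (ImplicitVar.mapKTilde F G) (ImplicitVar.pair zbar 0)
          (ImplicitVar.dom (ImplicitVar.mapKTilde F G)) ∧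
        ∀ l ∈ ImplicitVar.mapK F G zbar,
          ImplicitVar.MetricallySubregularAt (ImplicitVar.mapHTilde F G)
            (ImplicitVar.pair (ImplicitVar.pair zbar 0) (ImplicitVar.pair zbar l)) 0) →
      ImplicitVar.ExplicitlyMStationary f F G M zbar) ∧
    -- (c)
    ((∃ l ∈ ImplicitVar.mapK F G zbar,
        ImplicitVar.MetricallySubregularAt (ImplicitVar.mapCalHM F G M)
          (ImplicitVar.pair zbar l) 0 ∧
        ImplicitVar.Inc F G zbar l) →
      ImplicitVar.ExplicitlyMStationary f F G M zbar) ∧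
    -- (d)
    ((∃ l ∈ ImplicitVar.mapK F G zbar,
        ImplicitVar.MetricallySubregularAt (ImplicitVar.mapFrakHM F G M)
          (ImplicitVar.pair zbar l) 0) →
      ImplicitVar.ExplicitlyMStationary f F G M zbar) := by
  refine ⟨fun ⟨hHM, _, h⟩ => ?_, fun ⟨hHM, _, h⟩ => ?_, fun ⟨l, hl, hH, hInc⟩ => ?_,
    fun ⟨l, hl, hH⟩ => ?_⟩
  · obtain ⟨l, hlF, hlG⟩ := mem_iUnion₂.1 hz.1.1
    obtain ⟨hH, hInc⟩ := h l ⟨hlF, hlG⟩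
    exact ImplicitVar.explicitlyMStationary_of_mapHHat hf hF hG hM hz ⟨hlF, hlG⟩ hInc hHM hH
  · obtain ⟨l, hlF, hlG⟩ := mem_iUnion₂.1 hz.1.1
    exact ImplicitVar.explicitlyMStationary_of_mapHTilde hf hF hG hM hz ⟨hlF, hlG⟩ hHM
      (h l ⟨hlF, hlG⟩)
  · exact ImplicitVar.explicitlyMStationary_of_mapCalHM hf hF hG hM hz hl hInc hH
  · exact ImplicitVar.explicitlyMStationary_of_mapFrakHM hf hF hG hM hz hl hH
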